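/- Let $M$ be a Banach space over $\mathbf{Q}_2$ with an orthonormal Banach basis $e_1,e_2,\ldots$, that is, $|e_i|=1$ for all $i$, every $m\in M$ can be written uniquely as $m=\sum_i a_ie_i$ with $a_i\in\mathbf{Q}_2$, $a_i\to0$, and then $|m|=\max_i|a_i|$. The matrix $(c_{i,j})$ of a continuous linear map $\phi:M\to M$ is given by $\phi(e_j)=\sum_i c_{i,j}e_i$. For a compact $\phi$ with matrix $X$, the Newton polygon of $\phi$ is that of the power series $\det(1-TX)=\sum_{n\ge0}(-1)^n c_nT^n$, where $c_n$ is the sum of all $n\times n$ principal minors of $X$; that is, it is the lower boundary of the convex hull in $\mathbf{R}^2$ of the points $(n,v_2(c_n))$, $n\geq0$, $c_n\neq0$. Let $A$, $D$, $B$ be continuous linear endomorphisms of $M$ such that all entries of the matrices of $A-\mathrm{Id}$ and of $B-\mathrm{Id}$ lie in $2\mathbf{Z}_2$, the matrix of $D$ is diagonal with entries in $\mathbf{Z}_2$, and $D$ is compact. Let $U=ADB$. Then $U$ is compact, for every $n$ the sums of all $n\times n$ principal minors of the matrices of $U$ and of $D$ converge, and $U$ and $D$ have the same Newton polygon. -/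

import Mathlib

open Filter Topology

/-- An orthonormal Banach basis, indexed by `ℕ`, of a normed space `M` over `ℚ_[p]`: vectors of
norm `1` such that every `m : M` is in exactly one way a sum `∑ aᵢ eᵢ` with `aᵢ → 0`, and then
`‖m‖ = max ‖aᵢ‖`. -/
structure OrthonormalBanachBasis (p : ℕ) [Fact p.Prime] (M : Type*) [NormedAddCommGroup M]
    [NormedSpace ℚ_[p] M] where
  /-- the basis vectors -/
  vec : ℕ → M
  /-- the coefficients of an element -/
  coeff : M → ℕ → ℚ_[p]
  norm_vec : ∀ i, ‖vec i‖ = 1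
  coeff_tendsto : ∀ m, Tendsto (coeff m) atTop (𝓝 0)
  hasSum_coeff : ∀ m, HasSum (fun i => coeff m i • vec i) m
  coeff_unique : ∀ (m : M) (a : ℕ → ℚ_[p]), Tendsto a atTop (𝓝 0) →
    HasSum (fun i => a i • vec i) m → a = coeff m
  norm_isGreatest : ∀ m, IsGreatest (Set.range fun i => ‖coeff m i‖) ‖m‖

/-- The matrix `(c i j)` of a continuous endomorphism: `φ (e j) = ∑ i, c i j • e i`. -/
noncomputable def OrthonormalBanachBasis.matrixOf {p : ℕ} [Fact p.Prime] {M : Type*} [NormedAddCommGroup M]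
    [NormedSpace ℚ_[p] M] (b : OrthonormalBanachBasis p M) (φ : M →L[ℚ_[p]] M) :
    Matrix ℕ ℕ ℚ_[p] :=
  fun i j => b.coeff (φ (b.vec j)) i

/-- All entries lie in `ℤ_[p]`. -/
def IsIntegralMatrix {p : ℕ} [Fact p.Prime] (X : Matrix ℕ ℕ ℚ_[p]) : Prop :=
  ∀ i j, ∃ c : ℤ_[p], X i j = c

/-- All entries of `X - 1` lie in `p ℤ_[p]`, that is, `X ≡ Id mod p`. -/
def IsCongruentToOne {p : ℕ} [Fact p.Prime] (X : Matrix ℕ ℕ ℚ_[p]) : Prop :=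
  ∀ i j, ∃ c : ℤ_[p], X i j - (1 : Matrix ℕ ℕ ℚ_[p]) i j = (p : ℚ_[p]) * c

/-- The principal minor of an infinite matrix attached to a finite set of indices. -/
def principalMinor {K : Type*} [CommRing K] (X : Matrix ℕ ℕ K) (S : Finset ℕ) : K :=
  (X.submatrix (fun i : S => (i : ℕ)) (fun i : S => (i : ℕ))).det

/-- The sums of all principal minors of each size converge. -/
def HasPrincipalMinorSums {p : ℕ} [Fact p.Prime] (X : Matrix ℕ ℕ ℚ_[p]) : Prop :=
  ∀ n : ℕ, Summable fun S : {S : Finset ℕ // S.card = n} => principalMinor X S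

/-- The characteristic power series `det (1 - T X)`: its `n`-th coefficient is `(-1) ^ n` times the
sum of all `n × n` principal minors of `X`. It is meaningful when `HasPrincipalMinorSums X`. -/
noncomputable def charSeries {p : ℕ} [Fact p.Prime] (X : Matrix ℕ ℕ ℚ_[p]) :
    PowerSeries ℚ_[p] :=
  PowerSeries.mk fun n =>
    (-1) ^ n * ∑' S : {S : Finset ℕ // S.card = n}, principalMinor X S

/-- The points `(n, v (cₙ))` of a power series `∑ cₙ Tⁿ`; zero coefficients (valuation `+∞`)
give no point. -/
def newtonPoints {p : ℕ} [Fact p.Prime] (F : PowerSeries ℚ_[p]) : Set (ℝ × ℝ) :=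
  {P | ∃ n : ℕ, PowerSeries.coeff n F ≠ 0 ∧
    P = ((n : ℝ), ((PowerSeries.coeff n F).valuation : ℝ))}

/-- The lower boundary of the convex hull of a set in the plane. -/
def lowerConvexHull (s : Set (ℝ × ℝ)) : Set (ℝ × ℝ) :=
  {P | P ∈ convexHull ℝ s ∧ ∀ Q ∈ convexHull ℝ s, Q.1 = P.1 → P.2 ≤ Q.2}

/-- The Newton polygon of a power series over `ℚ_[p]`. -/
def newtonPolygon {p : ℕ} [Fact p.Prime] (F : PowerSeries ℚ_[p]) : Set (ℝ × ℝ) :=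
  lowerConvexHull (newtonPoints F)

/-! ### Principal minors of a product `a · diag(d) · b` with `a`, `b` congruent to `1` mod `p` -/

section Determinants

variable {p : ℕ} [Fact p.Prime]

/-! Let `d k` be the diagonal entries of `D`; compactness forces `d k → 0`. Expand a principal minor
of `ADB` over maps `f` from its index set to `ℕ`: each term is at most the product of the `d k` over
the image of `f` in norm. The inclusion of `K` gives `∏ k ∈ K, d k` up to a factor `≡ 1 mod p`;
every other term with image `K` uses an off-diagonal entry of `A` and gains a factor `p`. So `v
(c_n)` is at least the minimum of `v (∏ k ∈ L, d k)` over `L.card = n`, with equality when the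
minimiser is unique (`norm_tsum_principalMinor_sub_le`).

The sublevel sets `K m`, where `d i ≠ 0` and `v (d i) < m`, are such unique minimisers. The segment
joining the points of `K m` and `K (m + 1)` has slope `m`, and no `L` gives a point below these
segments (`exists_mem_convexHull_sublevel_le`). Hence the polygon depends on `d` alone
(`newtonPolygon_charSeries_eq`), and `D` itself is the case `A = B = Id`. -/

theorem norm_det_le_of_row_le {ι : Type*} [Fintype ι] [DecidableEq ι] {N : Matrix ι ι ℚ_[p]}
    (hN : ∀ i j, ‖N i j‖ ≤ 1) (i₀ : ι) {C : ℝ} (hC : ∀ j, ‖N i₀ j‖ ≤ C) : ‖N.det‖ ≤ C := by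
  have hC0 : 0 ≤ C := (norm_nonneg _).trans (hC i₀)
  rw [← Matrix.det_transpose, Matrix.det_apply']
  refine IsUltrametricDist.norm_sum_le_of_forall_le_of_nonneg hC0 fun σ _ => ?_
  have hs : ‖((Equiv.Perm.sign σ : ℤ) : ℚ_[p])‖ = 1 := by
    rcases Int.units_eq_one_or (Equiv.Perm.sign σ) with h | h <;> simp [h]
  rw [norm_mul, hs, one_mul, norm_prod, ← Finset.mul_prod_erase _ _ (Finset.mem_univ i₀)]
  refine (mul_le_mul (hC _) (Finset.prod_le_one (fun _ _ => norm_nonneg _) fun _ _ => hN _ _)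
    (Finset.prod_nonneg fun _ _ => norm_nonneg _) hC0).trans_eq (mul_one C)

theorem norm_det_le_one {ι : Type*} [Fintype ι] [DecidableEq ι] {N : Matrix ι ι ℚ_[p]}
    (hN : ∀ i j, ‖N i j‖ ≤ 1) : ‖N.det‖ ≤ 1 := by
  rcases isEmpty_or_nonempty ι with h | ⟨⟨i⟩⟩
  · simp
  · exact norm_det_le_of_row_le hN i (hN i)

theorem norm_prod_sub_one_le {ι : Type*} (s : Finset ι) {x : ι → ℚ_[p]} {C : ℝ} (hC0 : 0 ≤ C)
    (hx : ∀ i ∈ s, ‖x i‖ ≤ 1) (hx1 : ∀ i ∈ s, ‖x i - 1‖ ≤ C) : ‖∏ i ∈ s, x i - 1‖ ≤ C := by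
  classical
  induction s using Finset.induction_on with
  | empty => simpa using hC0
  | insert i s his ih =>
    simp only [Finset.mem_insert, forall_eq_or_imp] at hx hx1
    rw [Finset.prod_insert his]
    have : x i * ∏ j ∈ s, x j - 1 = x i * (∏ j ∈ s, x j - 1) + (x i - 1) := by ring
    rw [this]
    refine (Padic.nonarchimedean _ _).trans (max_le ?_ hx1.1)
    rw [norm_mul]
    exact (mul_le_of_le_one_left (norm_nonneg _) hx.1).trans (ih hx.2 hx1.2)

theorem IsCongruentToOne.norm_sub_one_le {X : Matrix ℕ ℕ ℚ_[p]} (h : IsCongruentToOne X)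
    (i j : ℕ) : ‖X i j - (1 : Matrix ℕ ℕ ℚ_[p]) i j‖ ≤ (p : ℝ)⁻¹ := by
  obtain ⟨c, hc⟩ := h i j
  rw [hc, norm_mul, Padic.norm_p]
  exact mul_le_of_le_one_right (by positivity) c.norm_le_one

theorem inv_prime_le_one : (p : ℝ)⁻¹ ≤ 1 :=
  inv_le_one_of_one_le₀ (by exact_mod_cast (Fact.out : p.Prime).one_lt.le)

theorem IsCongruentToOne.norm_le_one {X : Matrix ℕ ℕ ℚ_[p]} (h : IsCongruentToOne X)
    (i j : ℕ) : ‖X i j‖ ≤ 1 := by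
  have h1 := h.norm_sub_one_le i j
  rw [← sub_add_cancel (X i j) ((1 : Matrix ℕ ℕ ℚ_[p]) i j)]
  refine (Padic.nonarchimedean _ _).trans (max_le (h1.trans inv_prime_le_one) ?_)
  rw [Matrix.one_apply]
  split_ifs <;> simp

theorem IsCongruentToOne.norm_apply_le_of_ne {X : Matrix ℕ ℕ ℚ_[p]} (h : IsCongruentToOne X)
    {i j : ℕ} (hij : i ≠ j) : ‖X i j‖ ≤ (p : ℝ)⁻¹ := by
  simpa [Matrix.one_apply_ne hij] using h.norm_sub_one_le i j

theorem IsCongruentToOne.norm_apply_self_sub_one_le {X : Matrix ℕ ℕ ℚ_[p]}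
    (h : IsCongruentToOne X) (i : ℕ) : ‖X i i - 1‖ ≤ (p : ℝ)⁻¹ := by
  simpa using h.norm_sub_one_le i i

theorem IsCongruentToOne.norm_principalMinor_sub_one_le {X : Matrix ℕ ℕ ℚ_[p]}
    (h : IsCongruentToOne X) (S : Finset ℕ) : ‖principalMinor X S - 1‖ ≤ (p : ℝ)⁻¹ := by
  have hp0 : (0 : ℝ) ≤ (p : ℝ)⁻¹ := by positivity
  rw [principalMinor, Matrix.det_apply', ← Finset.add_sum_erase _ _ (Finset.mem_univ 1),
    add_sub_right_comm]
  refine (Padic.nonarchimedean _ _).trans (max_le ?_ ?_)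
  · simp only [Equiv.Perm.sign_one, Units.val_one, Int.cast_one, one_mul, Equiv.Perm.one_apply,
      Matrix.submatrix_apply]
    exact norm_prod_sub_one_le _ hp0 (fun i _ => h.norm_le_one _ _)
      fun i _ => h.norm_apply_self_sub_one_le _
  · refine IsUltrametricDist.norm_sum_le_of_forall_le_of_nonneg hp0 fun σ hσ => ?_
    obtain ⟨i, hi⟩ : ∃ i, σ i ≠ i := by
      by_contra! hc
      exact (Finset.ne_of_mem_erase hσ) (Equiv.ext hc)
    have hs : ‖((Equiv.Perm.sign σ : ℤ) : ℚ_[p])‖ = 1 := by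
      rcases Int.units_eq_one_or (Equiv.Perm.sign σ) with h | h <;> simp [h]
    rw [norm_mul, hs, one_mul, norm_prod, ← Finset.mul_prod_erase _ _ (Finset.mem_univ i)]
    refine (mul_le_mul (h.norm_apply_le_of_ne fun h' => hi (Subtype.ext h'))
      (Finset.prod_le_one (fun _ _ => norm_nonneg _) fun _ _ => h.norm_le_one _ _)
      (Finset.prod_nonneg fun _ _ => norm_nonneg _) hp0).trans_eq (mul_one _)

/-- Half of Cauchy–Binet: multilinearity in the rows only, so the sum runs over maps `f` rather than
subsets. -/
theorem det_sum_mul_mul {R ι κ : Type*} [CommRing R] [Fintype ι] [DecidableEq ι] [DecidableEq κ]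
    (T : Finset κ)
    (a : ι → κ → R) (d : κ → R) (b : κ → ι → R) :
    (Matrix.of fun i j => ∑ k ∈ T, a i k * d k * b k j).det =
      ∑ f ∈ Fintype.piFinset fun _ : ι => T,
        (∏ i, a i (f i)) * (∏ i, d (f i)) * (Matrix.of fun i j => b (f i) j).det := by
  have h1 : (Matrix.of fun i j => ∑ k ∈ T, a i k * d k * b k j) =
      fun i => ∑ k ∈ T, (a i k * d k) • b k := by
    ext i j
    simp [Finset.sum_apply]
  rw [h1]
  change (Matrix.detRowAlternating (R := R) (n := ι)).toMultilinearMap _ = _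
  rw [MultilinearMap.map_sum_finset]
  refine Finset.sum_congr rfl fun f _ => ?_
  rw [MultilinearMap.map_smul_univ, Finset.prod_mul_distrib, smul_eq_mul]
  rfl

/-- A non-injective `f` repeats a row of `b`; an image other than `K` is bounded by `hC`; image `K`
without being the inclusion forces some `f i ≠ i`, hence a small entry of `a`. -/
theorem norm_expansion_term_sub_le {a b : Matrix ℕ ℕ ℚ_[p]} {d : ℕ → ℚ_[p]}
    (ha : IsCongruentToOne a) (hb : IsCongruentToOne b) {K : Finset ℕ} {C : ℝ}
    (hC0 : 0 ≤ C) (hC : ∀ L : Finset ℕ, L.card = K.card → L ≠ K → ‖∏ k ∈ L, d k‖ ≤ C)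
    (hK : ‖∏ k ∈ K, d k‖ * (p : ℝ)⁻¹ ≤ C) {S : Finset ℕ} (hS : S.card = K.card) (f : S → ℕ) :
    ‖(∏ i : S, a i (f i)) * (∏ i, d (f i)) * (Matrix.of fun i j : S => b (f i) j).det -
      if S = K ∧ f = Subtype.val then ∏ k ∈ K, d k else 0‖ ≤ C := by
  have hdet : ‖(Matrix.of fun i j : S => b (f i) j).det‖ ≤ 1 :=
    norm_det_le_one fun i j => hb.norm_le_one _ _
  have hprod : ‖∏ i : S, a i (f i)‖ ≤ 1 := by
    rw [norm_prod]
    exact Finset.prod_le_one (fun _ _ => norm_nonneg _) fun _ _ => ha.norm_le_one _ _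
  split_ifs with hSf
  · obtain ⟨rfl, rfl⟩ := hSf
    have h1 : ∏ i : S, d i = ∏ k ∈ S, d k := Finset.prod_coe_sort S d
    have h2 : (Matrix.of fun i j : S => b i j).det = principalMinor b S := rfl
    rw [h1, h2] at *
    have h3 : (∏ i : S, a i i) * (∏ k ∈ S, d k) * principalMinor b S - ∏ k ∈ S, d k =
        (∏ k ∈ S, d k) *
          ((∏ i : S, a i i) * (principalMinor b S - 1) + (∏ i : S, a i i - 1)) := by ring
    rw [h3, norm_mul]
    refine (mul_le_mul_of_nonneg_left ?_ (norm_nonneg _)).trans hK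
    refine (Padic.nonarchimedean _ _).trans (max_le ?_ ?_)
    · rw [norm_mul]
      exact (mul_le_of_le_one_left (norm_nonneg _) hprod).trans
        (hb.norm_principalMinor_sub_one_le S)
    · exact norm_prod_sub_one_le _ (by positivity) (fun i _ => ha.norm_le_one _ _)
        fun i _ => ha.norm_apply_self_sub_one_le _
  · rw [sub_zero]
    by_cases hf : Function.Injective f
    · have himg : ∏ i, d (f i) = ∏ k ∈ Finset.univ.image f, d k :=
        (Finset.prod_image fun _ _ _ _ h => hf h).symm
      have hcard : (Finset.univ.image f).card = K.card := by
        rw [Finset.card_image_of_injective _ hf, Finset.card_univ, Fintype.card_coe, hS]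
      rw [norm_mul, norm_mul, himg]
      refine (mul_le_of_le_one_right (by positivity) hdet).trans ?_
      by_cases hL : Finset.univ.image f = K
      · obtain ⟨i, hi⟩ : ∃ i : S, (i : ℕ) ≠ f i := by
          by_contra! hc
          have hf' : f = Subtype.val := funext fun i => (hc i).symm
          refine hSf ⟨?_, hf'⟩
          rw [← hL, hf']
          ext x
          simp
        rw [hL, mul_comm]
        refine (mul_le_mul_of_nonneg_left ?_ (norm_nonneg _)).trans hK
        rw [norm_prod, ← Finset.mul_prod_erase _ _ (Finset.mem_univ i)]
        refine (mul_le_mul (ha.norm_apply_le_of_ne hi)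
          (Finset.prod_le_one (fun _ _ => norm_nonneg _) fun _ _ => ha.norm_le_one _ _)
          (Finset.prod_nonneg fun _ _ => norm_nonneg _) (by positivity)).trans_eq (mul_one _)
      · exact (mul_le_of_le_one_left (norm_nonneg _) hprod).trans (hC _ hcard hL)
    · obtain ⟨i, j, hij, hne⟩ := Function.not_injective_iff.1 hf
      rw [Matrix.det_zero_of_row_eq hne (by ext; simp [hij])]
      simpa using hC0

theorem norm_principalMinor_sub_le {a b X : Matrix ℕ ℕ ℚ_[p]} {d : ℕ → ℚ_[p]}
    (ha : IsCongruentToOne a) (hb : IsCongruentToOne b)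
    (hX : ∀ i j, HasSum (fun k => a i k * d k * b k j) (X i j)) {K : Finset ℕ} {C : ℝ}
    (hC0 : 0 ≤ C) (hC : ∀ L : Finset ℕ, L.card = K.card → L ≠ K → ‖∏ k ∈ L, d k‖ ≤ C)
    (hK : ‖∏ k ∈ K, d k‖ * (p : ℝ)⁻¹ ≤ C) {S : Finset ℕ} (hS : S.card = K.card) :
    ‖principalMinor X S - if S = K then ∏ k ∈ K, d k else 0‖ ≤ C := by
  have hlim : Tendsto (fun T : Finset ℕ =>
      (Matrix.of fun i j : S => ∑ k ∈ T, a i k * d k * b k j).det) atTop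
      (𝓝 (principalMinor X S)) := by
    refine ((continuous_id.matrix_det).tendsto
      (X.submatrix (fun i : S => (i : ℕ)) (fun i : S => (i : ℕ)))).comp ?_
    exact tendsto_pi_nhds.2 fun i => tendsto_pi_nhds.2 fun j => hX i j
  refine le_of_tendsto (hlim.sub_const _).norm ?_
  -- Once `S ⊆ T`, the inclusion of `S` is among the maps into `T`.
  filter_upwards [eventually_ge_atTop S] with T hT
  rw [det_sum_mul_mul T (fun (i : S) k => a i k) d fun k (j : S) => b k j]
  have hite : (if S = K then ∏ k ∈ K, d k else 0) =
      ∑ f ∈ Fintype.piFinset fun _ : S => T,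
        if S = K ∧ f = Subtype.val then ∏ k ∈ K, d k else 0 := by
    by_cases hSK : S = K
    · rw [if_pos hSK, Finset.sum_eq_single Subtype.val]
      · simp [hSK]
      · intro f _ hf
        simp [hf]
      · intro h
        exact absurd (Fintype.mem_piFinset.2 fun i : S => hT i.2) h
    · simp [hSK]
  rw [hite, ← Finset.sum_sub_distrib]
  exact IsUltrametricDist.norm_sum_le_of_forall_le_of_nonneg hC0 fun f _ =>
    norm_expansion_term_sub_le ha hb hC0 hC hK hS f

/-- Only finitely many `S` lie in `range I`; any other minor contains a row of small entries. -/
theorem hasPrincipalMinorSums_of_tendsto_rows {X : Matrix ℕ ℕ ℚ_[p]} (hX : ∀ i j, ‖X i j‖ ≤ 1)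
    (hrows : ∀ ε > 0, ∀ᶠ i in atTop, ∀ j, ‖X i j‖ ≤ ε) : HasPrincipalMinorSums X := by
  intro n
  refine NonarchimedeanAddGroup.summable_of_tendsto_cofinite_zero ?_
  rw [Metric.tendsto_nhds]
  intro ε hε
  obtain ⟨I, hI⟩ := eventually_atTop.1 (hrows (ε / 2) (half_pos hε))
  rw [eventually_cofinite]
  have hfin : {S : {S : Finset ℕ // S.card = n} | S.1 ⊆ Finset.range I}.Finite :=
    ((Finset.range I).powerset.finite_toSet.preimage Subtype.val_injective.injOn).subset
      fun S hS => Finset.mem_coe.2 (Finset.mem_powerset.2 hS)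
  refine hfin.subset fun S hS => ?_
  by_contra hcon
  obtain ⟨i, hiS, hi⟩ := Finset.not_subset.1 hcon
  refine hS ?_
  rw [dist_zero_right]
  refine lt_of_le_of_lt ?_ (half_lt_self hε)
  exact norm_det_le_of_row_le (fun _ _ => hX _ _) ⟨i, hiS⟩
    fun j => hI i (by simpa using hi) _

theorem norm_le_one_of_hasSum {a b X : Matrix ℕ ℕ ℚ_[p]} {d : ℕ → ℚ_[p]}
    (ha : IsCongruentToOne a) (hb : IsCongruentToOne b) (hd : ∀ k, ‖d k‖ ≤ 1)
    (hX : ∀ i j, HasSum (fun k => a i k * d k * b k j) (X i j)) (i j : ℕ) : ‖X i j‖ ≤ 1 := by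
  rw [← (hX i j).tsum_eq]
  refine IsUltrametricDist.norm_tsum_le_of_forall_le_of_nonneg zero_le_one fun k => ?_
  rw [norm_mul, norm_mul]
  exact mul_le_one₀ (mul_le_one₀ (ha.norm_le_one _ _) (norm_nonneg _) (hd k)) (norm_nonneg _)
    (hb.norm_le_one _ _)

/-- For `k ≥ N` the factor `d k` is small; the finitely many columns `k < N` of `a` tend to `0`. -/
theorem eventually_forall_norm_le_of_hasSum {a b X : Matrix ℕ ℕ ℚ_[p]} {d : ℕ → ℚ_[p]}
    (ha : IsCongruentToOne a) (hb : IsCongruentToOne b)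
    (hacol : ∀ k, Tendsto (fun i => a i k) atTop (𝓝 0))
    (hd : ∀ k, ‖d k‖ ≤ 1) (hd0 : Tendsto d atTop (𝓝 0))
    (hX : ∀ i j, HasSum (fun k => a i k * d k * b k j) (X i j)) {ε : ℝ} (hε : 0 < ε) :
    ∀ᶠ i in atTop, ∀ j, ‖X i j‖ ≤ ε := by
  obtain ⟨N, hN⟩ := Metric.tendsto_atTop.1 hd0 ε hε
  have h1 : ∀ᶠ i in atTop, ∀ k ∈ Finset.range N, ‖a i k‖ < ε :=
    (Finset.eventually_all _).2 fun k _ => by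
      simpa using Metric.tendsto_nhds.1 (hacol k) ε hε
  filter_upwards [h1] with i hi j
  rw [← (hX i j).tsum_eq]
  refine IsUltrametricDist.norm_tsum_le_of_forall_le_of_nonneg hε.le fun k => ?_
  rw [norm_mul, norm_mul]
  refine (mul_le_of_le_one_right (by positivity) (hb.norm_le_one _ _)).trans ?_
  rcases lt_or_ge k N with hk | hk
  · exact (mul_le_of_le_one_right (norm_nonneg _) (hd k)).trans (hi k (by simpa using hk)).le
  · exact (mul_le_of_le_one_left (norm_nonneg _) (ha.norm_le_one _ _)).trans
      (by simpa using (hN k hk).le)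

theorem norm_tsum_principalMinor_sub_le {a b X : Matrix ℕ ℕ ℚ_[p]} {d : ℕ → ℚ_[p]}
    (ha : IsCongruentToOne a) (hb : IsCongruentToOne b)
    (hX : ∀ i j, HasSum (fun k => a i k * d k * b k j) (X i j)) (hsum : HasPrincipalMinorSums X)
    {n : ℕ} {K : Finset ℕ} (hn : K.card = n) {C : ℝ}
    (hC0 : 0 ≤ C) (hC : ∀ L : Finset ℕ, L.card = K.card → L ≠ K → ‖∏ k ∈ L, d k‖ ≤ C)
    (hK : ‖∏ k ∈ K, d k‖ * (p : ℝ)⁻¹ ≤ C) :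
    ‖∑' S : {S : Finset ℕ // S.card = n}, principalMinor X S - ∏ k ∈ K, d k‖ ≤ C := by
  have h1 := (hsum n).hasSum.sub
    (hasSum_ite_eq (⟨K, hn⟩ : {S : Finset ℕ // S.card = n}) (∏ k ∈ K, d k))
  rw [← h1.tsum_eq]
  refine IsUltrametricDist.norm_tsum_le_of_forall_le_of_nonneg hC0 fun S => ?_
  have h2 := norm_principalMinor_sub_le ha hb hX hC0 hC hK (S.2.trans hn.symm)
  simpa only [Subtype.ext_iff] using h2

end Determinants

/-! ### Lower convex hulls -/

theorem lowerConvexHull_eq_of_subset_of_forall_exists_le {V P : Set (ℝ × ℝ)} (hVP : V ⊆ P)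
    (h : ∀ x ∈ P, ∃ y ∈ convexHull ℝ V, y.1 = x.1 ∧ y.2 ≤ x.2) :
    lowerConvexHull P = lowerConvexHull V := by
  have hmono := convexHull_mono (𝕜 := ℝ) hVP
  have hdom : convexHull ℝ P ⊆ {x | ∃ y ∈ convexHull ℝ V, y.1 = x.1 ∧ y.2 ≤ x.2} := by
    refine convexHull_min h ?_
    rintro x ⟨y, hy, hy1, hy2⟩ x' ⟨y', hy', hy1', hy2'⟩ s t hs ht hst
    refine ⟨s • y + t • y', convex_convexHull ℝ V hy hy' hs ht hst, ?_, ?_⟩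
    · simp [hy1, hy1']
    · simp only [Prod.snd_add, Prod.smul_snd, smul_eq_mul]
      gcongr
  ext x
  constructor
  · rintro ⟨hx, hmin⟩
    obtain ⟨y, hy, hy1, hy2⟩ := hdom hx
    have hxy : y = x := Prod.ext hy1 (le_antisymm hy2 (hmin y (hmono hy) hy1))
    exact ⟨hxy ▸ hy, fun Q hQ => hmin Q (hmono hQ)⟩
  · rintro ⟨hx, hmin⟩
    refine ⟨hmono hx, fun Q hQ hQx => ?_⟩
    obtain ⟨y, hy, hy1, hy2⟩ := hdom hQ
    exact (hmin y hy (hy1.trans hQx)).trans hy2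

/-! ### Sublevel sets of the valuation and the vertices of the polygon -/

section Valuations

variable {p : ℕ} [Fact p.Prime]

theorem one_lt_cast_prime : (1 : ℝ) < p := by
  exact_mod_cast (Fact.out : p.Prime).one_lt

theorem Padic.norm_le_norm_iff_valuation_le {x y : ℚ_[p]} (hx : x ≠ 0) (hy : y ≠ 0) :
    ‖x‖ ≤ ‖y‖ ↔ y.valuation ≤ x.valuation := by
  rw [Padic.norm_eq_zpow_neg_valuation hx, Padic.norm_eq_zpow_neg_valuation hy,
    zpow_le_zpow_iff_right₀ one_lt_cast_prime, neg_le_neg_iff]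

theorem Padic.valuation_eq_of_norm_eq {x y : ℚ_[p]} (hx : x ≠ 0) (h : ‖x‖ = ‖y‖) :
    x.valuation = y.valuation := by
  have hy : y ≠ 0 := norm_ne_zero_iff.1 (h ▸ norm_ne_zero_iff.2 hx)
  exact le_antisymm ((norm_le_norm_iff_valuation_le hy hx).1 h.ge)
    ((norm_le_norm_iff_valuation_le hx hy).1 h.le)

theorem Padic.norm_le_mul_inv_of_norm_lt {x y : ℚ_[p]} (h : ‖x‖ < ‖y‖) :
    ‖x‖ ≤ ‖y‖ * (p : ℝ)⁻¹ := by
  have hy : y ≠ 0 := norm_pos_iff.1 ((norm_nonneg x).trans_lt h)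
  have hp : (p : ℝ) ≠ 0 := (zero_lt_one.trans one_lt_cast_prime).ne'
  rw [Padic.norm_eq_zpow_neg_valuation hy] at h ⊢
  rw [← zpow_sub_one₀ hp]
  exact (Padic.norm_lt_pow_iff_norm_le_pow_sub_one x _).1 h

theorem Padic.norm_mul_inv_prime_lt {x : ℚ_[p]} (hx : x ≠ 0) : ‖x‖ * (p : ℝ)⁻¹ < ‖x‖ :=
  mul_lt_of_lt_one_right (norm_pos_iff.2 hx) (inv_lt_one_of_one_lt₀ one_lt_cast_prime)

theorem Padic.valuation_prod {ι : Type*} (s : Finset ι) {d : ι → ℚ_[p]} (hd : ∀ i ∈ s, d i ≠ 0) :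
    (∏ i ∈ s, d i).valuation = ∑ i ∈ s, (d i).valuation := by
  classical
  induction s using Finset.induction_on with
  | empty => simp
  | insert i s his ih =>
    simp only [Finset.mem_insert, forall_eq_or_imp] at hd
    rw [Finset.prod_insert his, Finset.sum_insert his,
      Padic.valuation_mul hd.1 (Finset.prod_ne_zero_iff.2 hd.2), ih hd.2]

variable {d : ℕ → ℚ_[p]}

theorem finite_setOf_valuation_lt (hd0 : Tendsto d atTop (𝓝 0)) (m : ℤ) :
    {i | d i ≠ 0 ∧ (d i).valuation < m}.Finite := by
  have hp := one_lt_cast_prime (p := p)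
  have h := Metric.tendsto_nhds.1 hd0 ((p : ℝ) ^ (-m)) (zpow_pos (zero_lt_one.trans hp) _)
  rw [← Nat.cofinite_eq_atTop, eventually_cofinite] at h
  refine h.subset fun i hi hlt => ?_
  rw [dist_zero_right, Padic.norm_eq_zpow_neg_valuation hi.1, zpow_lt_zpow_iff_right₀ hp] at hlt
  have := hi.2
  omega

variable {K : ℕ → Finset ℕ} (hK : ∀ (m : ℕ) (i : ℕ), i ∈ K m ↔ d i ≠ 0 ∧ (d i).valuation < m)

include hK

theorem prod_sublevel_ne_zero (m : ℕ) : ∏ k ∈ K m, d k ≠ 0 :=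
  Finset.prod_ne_zero_iff.2 fun i hi => ((hK m i).1 hi).1

/-- Among nonzero entries the weight `v (d i) - m` is negative exactly on `K m`, so dropping `L \ K
m` and then adding `K m \ L` can only lower the sum. -/
theorem sum_sublevel_valuation_sub_le {m : ℕ} {L : Finset ℕ} (hL : ∀ i ∈ L, d i ≠ 0) :
    ∑ i ∈ K m, ((d i).valuation - (m : ℤ)) ≤ ∑ i ∈ L ∩ K m, ((d i).valuation - (m : ℤ)) ∧
    ∑ i ∈ L ∩ K m, ((d i).valuation - (m : ℤ)) ≤ ∑ i ∈ L, ((d i).valuation - (m : ℤ)) ∧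
    (¬ K m ⊆ L → ∑ i ∈ K m, ((d i).valuation - (m : ℤ)) <
      ∑ i ∈ L ∩ K m, ((d i).valuation - (m : ℤ))) := by
  have hneg : ∀ i ∈ K m, (d i).valuation - (m : ℤ) < 0 := fun i hi => by
    have := ((hK m i).1 hi).2
    omega
  have h1 := Finset.sum_inter_add_sum_sdiff (K m) L fun i => (d i).valuation - (m : ℤ)
  have h2 := Finset.sum_inter_add_sum_sdiff L (K m) fun i => (d i).valuation - (m : ℤ)
  rw [Finset.inter_comm] at h1
  refine ⟨?_, ?_, fun hsub => ?_⟩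
  · have : ∑ i ∈ K m \ L, ((d i).valuation - (m : ℤ)) ≤ 0 :=
      Finset.sum_nonpos fun i hi => (hneg i (Finset.mem_sdiff.1 hi).1).le
    omega
  · have : 0 ≤ ∑ i ∈ L \ K m, ((d i).valuation - (m : ℤ)) := by
      refine Finset.sum_nonneg fun i hi => ?_
      rw [Finset.mem_sdiff, hK] at hi
      by_contra hc
      exact hi.2 ⟨hL i hi.1, by omega⟩
    omega
  · have : ∑ i ∈ K m \ L, ((d i).valuation - (m : ℤ)) < 0 :=
      Finset.sum_neg (fun i hi => hneg i (Finset.mem_sdiff.1 hi).1)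
        (Finset.sdiff_nonempty.2 hsub)
    omega

theorem norm_prod_le_sublevel {m : ℕ} {L : Finset ℕ} (hcard : L.card = (K m).card)
    (hne : L ≠ K m) : ‖∏ k ∈ L, d k‖ ≤ ‖∏ k ∈ K m, d k‖ * (p : ℝ)⁻¹ := by
  by_cases h0 : ∏ k ∈ L, d k = 0
  · rw [h0, norm_zero]
    positivity
  have hL : ∀ i ∈ L, d i ≠ 0 := Finset.prod_ne_zero_iff.1 h0
  have hsub : ¬ K m ⊆ L := fun h => hne (Finset.eq_of_subset_of_card_le h hcard.le).symm
  obtain ⟨-, h2, h3⟩ := sum_sublevel_valuation_sub_le hK (m := m) hL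
  have h4 := (h3 hsub).trans_le h2
  -- Equal cardinalities make the shifts by `m` cancel.
  simp only [Finset.sum_sub_distrib, Finset.sum_const, hcard, sub_lt_sub_iff_right] at h4
  refine Padic.norm_le_mul_inv_of_norm_lt (lt_of_not_ge fun hle => ?_)
  rw [Padic.norm_le_norm_iff_valuation_le (prod_sublevel_ne_zero hK m) h0,
    Padic.valuation_prod _ hL, Padic.valuation_prod _ fun i hi => ((hK m i).1 hi).1] at hle
  omega

theorem exists_mem_convexHull_sublevel_le (hd : ∀ k, ‖d k‖ ≤ 1) {L : Finset ℕ}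
    (hL0 : ∏ k ∈ L, d k ≠ 0) :
    ∃ y ∈ convexHull ℝ (Set.range fun m : ℕ =>
        (((K m).card : ℝ), ((∏ k ∈ K m, d k).valuation : ℝ))),
      y.1 = (L.card : ℝ) ∧ y.2 ≤ ((∏ k ∈ L, d k).valuation : ℝ) := by
  have hL : ∀ i ∈ L, d i ≠ 0 := Finset.prod_ne_zero_iff.1 hL0
  have hKne : ∀ m, ∀ i ∈ K m, d i ≠ 0 := fun m i hi => ((hK m i).1 hi).1
  have hval : ∀ i, 0 ≤ (d i).valuation := fun i =>
    (Padic.norm_le_one_iff_val_nonneg _).1 (hd i)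
  have hex : ∃ m, L.card ≤ (K m).card := by
    refine ⟨(∑ i ∈ L, (d i).valuation).toNat + 1, Finset.card_le_card fun i hi => ?_⟩
    have := Finset.single_le_sum (fun i _ => hval i) hi
    exact (hK _ _).2 ⟨hL i hi, by omega⟩
  have hspec := Nat.find_spec hex
  cases hm : Nat.find hex with
  | zero =>
    rw [hm] at hspec
    have hK0 : K 0 = ∅ := Finset.eq_empty_of_forall_notMem fun i hi => by
      have := ((hK 0 i).1 hi).2
      have := hval i
      omega
    have hLe : L = ∅ := by simpa [hK0] using hspec
    refine ⟨_, subset_convexHull ℝ _ ⟨0, rfl⟩, ?_, ?_⟩ <;> simp [hK0, hLe]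
  | succ m =>
    rw [hm] at hspec
    have hlt : (K m).card < L.card := not_le.1 (Nat.find_min hex (by omega))
    have hsub : K m ⊆ K (m + 1) := fun i hi => by
      rw [hK] at hi ⊢
      exact ⟨hi.1, by push_cast; omega⟩
    -- Elements of `K (m + 1) \ K m` have valuation exactly `m`, hence weight `0`.
    have hstep : ∑ i ∈ K m, ((d i).valuation - (m : ℤ)) =
        ∑ i ∈ K (m + 1), ((d i).valuation - (m : ℤ)) := by
      refine Finset.sum_subset hsub fun i hi hi' => ?_
      rw [hK] at hi hi'
      have h1 := hi.2
      have h2 : ¬ (d i).valuation < m := fun h => hi' ⟨hi.1, h⟩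
      push_cast at h1
      omega
    obtain ⟨h1, h2, -⟩ := sum_sublevel_valuation_sub_le hK (m := m) hL
    have hle := h1.trans h2
    simp only [Finset.sum_sub_distrib, Finset.sum_const, nsmul_eq_mul] at hstep hle
    rw [← Padic.valuation_prod _ (hKne _), ← Padic.valuation_prod _ (hKne _)] at hstep
    rw [← Padic.valuation_prod _ (hKne _), ← Padic.valuation_prod _ hL] at hle
    have hstep' := congrArg (Int.cast : ℤ → ℝ) hstep
    have hle' : ((_ : ℤ) : ℝ) ≤ ((_ : ℤ) : ℝ) := Int.cast_le.2 hle
    push_cast at hstep' hle'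
    have hca : (0 : ℝ) < (K (m + 1)).card - (K m).card := by
      rw [sub_pos]
      exact_mod_cast hlt.trans_le hspec
    have hla : (0 : ℝ) ≤ L.card - (K m).card := by
      rw [sub_nonneg]
      exact_mod_cast hlt.le
    have hlc : (0 : ℝ) ≤ (K (m + 1)).card - L.card := by
      rw [sub_nonneg]
      exact_mod_cast hspec
    have hca' := hca.ne'
    -- The point of abscissa `L.card` on the segment from `K m` to `K (m + 1)`.
    refine ⟨_, convex_convexHull ℝ _ (subset_convexHull ℝ _ (Set.mem_range_self m))
      (subset_convexHull ℝ _ (Set.mem_range_self (m + 1))) (div_nonneg hlc hca.le) (div_nonneg hla hca.le)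
      (by field_simp; ring), ?_, ?_⟩
    · simp only [Prod.fst_add, Prod.smul_fst, smul_eq_mul]
      field_simp
      ring
    · simp only [Prod.snd_add, Prod.smul_snd, smul_eq_mul]
      have hy : ((∏ k ∈ K (m + 1), d k).valuation : ℝ) = (∏ k ∈ K m, d k).valuation +
          ((K (m + 1)).card - (K m).card) * m := by linarith
      rw [hy]
      refine le_of_eq_of_le (b := ((∏ k ∈ K m, d k).valuation : ℝ) +
        (L.card - (K m).card) * m) ?_ (by linarith)
      field_simp
      ring

theorem newtonPolygon_charSeries_eq (hd : ∀ k, ‖d k‖ ≤ 1) {a b X : Matrix ℕ ℕ ℚ_[p]}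
    (ha : IsCongruentToOne a) (hb : IsCongruentToOne b)
    (hX : ∀ i j, HasSum (fun k => a i k * d k * b k j) (X i j))
    (hsum : HasPrincipalMinorSums X) :
    newtonPolygon (charSeries X) = lowerConvexHull (Set.range fun m : ℕ =>
      (((K m).card : ℝ), ((∏ k ∈ K m, d k).valuation : ℝ))) := by
  have hnorm : ∀ n, ‖PowerSeries.coeff n (charSeries X)‖ =
      ‖∑' S : {S : Finset ℕ // S.card = n}, principalMinor X S‖ := fun n => by
    simp [charSeries]
  refine lowerConvexHull_eq_of_subset_of_forall_exists_le ?_ ?_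
  · rintro _ ⟨m, rfl⟩
    have hne := prod_sublevel_ne_zero hK m
    have h1 := norm_tsum_principalMinor_sub_le ha hb hX hsum (K := K m) rfl (by positivity)
      (fun L hL hLK => norm_prod_le_sublevel hK hL hLK) le_rfl
    have h2 : ‖∏ k ∈ K m, d k‖ =
        ‖PowerSeries.coeff (K m).card (charSeries X)‖ := by
      rw [hnorm]
      exact (Padic.norm_eq_of_norm_sub_lt_right
        (h1.trans_lt (Padic.norm_mul_inv_prime_lt hne))).symm
    exact ⟨(K m).card, norm_ne_zero_iff.1 (h2 ▸ norm_ne_zero_iff.2 hne),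
      by simp only [Padic.valuation_eq_of_norm_eq hne h2]⟩
  · rintro _ ⟨n, hn, rfl⟩
    obtain ⟨L, hLn, hL⟩ : ∃ L : Finset ℕ, L.card = n ∧
        ‖PowerSeries.coeff n (charSeries X)‖ ≤ ‖∏ k ∈ L, d k‖ := by
      by_contra! hcon
      have hC : ∀ L : Finset ℕ, L.card = n →
          ‖∏ k ∈ L, d k‖ ≤ ‖PowerSeries.coeff n (charSeries X)‖ * (p : ℝ)⁻¹ := fun L hL =>
        Padic.norm_le_mul_inv_of_norm_lt (hcon L hL)
      -- If every product were smaller than the coefficient, any set of size `n` could serve as `K`;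
      -- the coefficient would then be at most `p⁻¹` times itself in norm.
      have hcard := Finset.card_range n
      have h1 := norm_tsum_principalMinor_sub_le ha hb hX hsum hcard
        (C := ‖PowerSeries.coeff n (charSeries X)‖ * (p : ℝ)⁻¹) (by positivity)
        (fun L hL _ => hC L (hL.trans hcard))
        ((mul_le_of_le_one_right (norm_nonneg _) inv_prime_le_one).trans (hC _ hcard))
      have h2 := (Padic.nonarchimedean _ _).trans (max_le h1 (hC _ hcard))
      rw [sub_add_cancel, ← hnorm] at h2
      exact (Padic.norm_mul_inv_prime_lt hn).not_ge h2
    have hL0 : ∏ k ∈ L, d k ≠ 0 := norm_pos_iff.1 ((norm_pos_iff.2 hn).trans_le hL)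
    obtain ⟨y, hy, hy1, hy2⟩ := exists_mem_convexHull_sublevel_le hK hd hL0
    refine ⟨y, hy, hy1.trans (by rw [hLn]), hy2.trans ?_⟩
    exact Int.cast_le.2 ((Padic.norm_le_norm_iff_valuation_le hn hL0).1 hL)

end Valuations

/-! ### Matrices of operators in an orthonormal basis -/

namespace OrthonormalBanachBasis

variable {p : ℕ} [Fact p.Prime] {M : Type*} [NormedAddCommGroup M] [NormedSpace ℚ_[p] M]
  (b : OrthonormalBanachBasis p M)

theorem norm_coeff_le (m : M) (i : ℕ) : ‖b.coeff m i‖ ≤ ‖m‖ :=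
  (b.norm_isGreatest m).2 ⟨i, rfl⟩

/-- The `i`-th coordinate as a continuous linear functional. -/
noncomputable def coeffCLM (i : ℕ) : M →L[ℚ_[p]] ℚ_[p] :=
  LinearMap.mkContinuous
    { toFun := fun m => b.coeff m i
      map_add' := fun m m' => by
        have h := b.coeff_unique (m + m') (fun i => b.coeff m i + b.coeff m' i)
          (by simpa using (b.coeff_tendsto m).add (b.coeff_tendsto m'))
          (by simpa only [add_smul] using (b.hasSum_coeff m).add (b.hasSum_coeff m'))
        exact (congrFun h i).symm
      map_smul' := fun c m => by
        have h := b.coeff_unique (c • m) (fun i => c * b.coeff m i)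
          (by simpa using (b.coeff_tendsto m).const_mul c)
          (by simpa only [mul_smul] using (b.hasSum_coeff m).const_smul c)
        exact (congrFun h i).symm }
    1 fun m => by simpa using b.norm_coeff_le m i

@[simp]
theorem coeffCLM_apply (i : ℕ) (m : M) : b.coeffCLM i m = b.coeff m i := rfl

theorem hasSum_coeff_apply (φ : M →L[ℚ_[p]] M) (m : M) (i : ℕ) :
    HasSum (fun k => b.coeff m k * b.matrixOf φ i k) (b.coeff (φ m) i) := by
  simpa [matrixOf] using ((b.coeffCLM i).comp φ).hasSum (b.hasSum_coeff m)

theorem coeff_apply_of_isDiag {D : M →L[ℚ_[p]] M} (hD : (b.matrixOf D).IsDiag) (m : M) (i : ℕ) :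
    b.coeff (D m) i = b.coeff m i * b.matrixOf D i i := by
  refine (b.hasSum_coeff_apply D m i).unique (hasSum_single i fun k hk => ?_)
  rw [hD hk.symm, mul_zero]

theorem hasSum_matrixOf_comp_comp (A B : M →L[ℚ_[p]] M) {D : M →L[ℚ_[p]] M}
    (hD : (b.matrixOf D).IsDiag) (i j : ℕ) :
    HasSum (fun k => b.matrixOf A i k * b.matrixOf D k k * b.matrixOf B k j)
      (b.matrixOf (A ∘L D ∘L B) i j) := by
  refine (b.hasSum_coeff_apply A (D (B (b.vec j))) i).congr_fun fun k => ?_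
  rw [b.coeff_apply_of_isDiag hD]
  simp only [matrixOf]
  ring

theorem matrixOf_id : b.matrixOf (ContinuousLinearMap.id ℚ_[p] M) = 1 := by
  ext i j
  have h := b.coeff_unique (b.vec j) (Pi.single j 1)
    (tendsto_const_nhds.congr' (by
      filter_upwards [eventually_gt_atTop j] with k hk
      simp [hk.ne']))
    (by
      convert hasSum_single (f := fun i => (Pi.single j 1 : ℕ → ℚ_[p]) i • b.vec i) j
        fun k hk => by simp [hk]
      simp)
  simp [matrixOf, ← h, Matrix.one_apply, Pi.single_apply]

/-- The vectors `D (e k) = d k • e k` lie in a compact set. If infinitely many had norm `≥ ε`, two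
would be within `ε` of each other, but the `k`-th coordinate of their difference is `d k`. -/
theorem tendsto_diag_of_isCompactOperator {D : M →L[ℚ_[p]] M} (hD : (b.matrixOf D).IsDiag)
    (hcomp : IsCompactOperator D) : Tendsto (fun k => b.matrixOf D k k) atTop (𝓝 0) := by
  obtain ⟨T, hT, hsub⟩ := hcomp.image_closedBall_subset_compact (f := (D : M →ₗ[ℚ_[p]] M)) 1
  have hmem : ∀ k, D (b.vec k) ∈ T := fun k =>
    hsub ⟨b.vec k, by simp [b.norm_vec k], rfl⟩
  rw [Metric.tendsto_nhds]
  intro ε hε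
  by_contra hcon
  rw [← Nat.cofinite_eq_atTop, eventually_cofinite] at hcon
  obtain ⟨t, ht, hcover⟩ := Metric.totallyBounded_iff.1 hT.totallyBounded (ε / 2) (half_pos hε)
  have hch : ∀ k, ∃ y ∈ t, dist (D (b.vec k)) y < ε / 2 := fun k => by
    simpa using hcover (hmem k)
  choose y hyt hy using hch
  obtain ⟨k, hk, l, -, hkl, hykl⟩ :=
    Set.Infinite.exists_ne_map_eq_of_mapsTo hcon (fun k _ => hyt k) ht
  have h1 : dist (D (b.vec k)) (D (b.vec l)) < ε := by
    have := dist_triangle_right (D (b.vec k)) (D (b.vec l)) (y k)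
    have h2 := hy l
    rw [← hykl] at h2
    linarith [hy k]
  refine hk ?_
  rw [dist_zero_right]
  refine lt_of_le_of_lt ?_ h1
  rw [dist_eq_norm]
  have h2 := b.norm_coeff_le (D (b.vec k) - D (b.vec l)) k
  rwa [← b.coeffCLM_apply, map_sub, b.coeffCLM_apply, b.coeffCLM_apply,
    show b.coeff (D (b.vec l)) k = 0 from hD hkl, sub_zero] at h2

end OrthonormalBanachBasis

/-! ### Conclusion -/

theorem isCongruentToOne_one {p : ℕ} [Fact p.Prime] :
    IsCongruentToOne (1 : Matrix ℕ ℕ ℚ_[p]) :=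
  fun i j => ⟨0, by simp⟩

theorem OrthonormalBanachBasis.hasPrincipalMinorSums_comp_comp {p : ℕ} [Fact p.Prime] {M : Type*}
    [NormedAddCommGroup M] [NormedSpace ℚ_[p] M] (b : OrthonormalBanachBasis p M)
    {A D B : M →L[ℚ_[p]] M}
    (hA : IsCongruentToOne (b.matrixOf A)) (hB : IsCongruentToOne (b.matrixOf B))
    (hd : ∀ k, ‖b.matrixOf D k k‖ ≤ 1) (hDdiag : (b.matrixOf D).IsDiag)
    (hDcomp : IsCompactOperator D) :
    HasPrincipalMinorSums (b.matrixOf (A ∘L D ∘L B)) := by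
  have hX := b.hasSum_matrixOf_comp_comp A B hDdiag
  exact hasPrincipalMinorSums_of_tendsto_rows (norm_le_one_of_hasSum hA hB hd hX)
    fun ε hε => eventually_forall_norm_le_of_hasSum hA hB (fun k => b.coeff_tendsto _) hd
      (b.tendsto_diag_of_isCompactOperator hDdiag hDcomp) hX hε

theorem mainTheorem8 {M : Type*} [NormedAddCommGroup M] [NormedSpace ℚ_[2] M] [CompleteSpace M]
    (b : OrthonormalBanachBasis 2 M) (A D B U : M →L[ℚ_[2]] M)
    (hA : IsCongruentToOne (b.matrixOf A)) (hB : IsCongruentToOne (b.matrixOf B))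
    (hDint : IsIntegralMatrix (b.matrixOf D)) (hDdiag : (b.matrixOf D).IsDiag)
    (hDcomp : IsCompactOperator D) (hU : U = A ∘L D ∘L B) :
    IsCompactOperator U ∧
      HasPrincipalMinorSums (b.matrixOf U) ∧ HasPrincipalMinorSums (b.matrixOf D) ∧
      newtonPolygon (charSeries (b.matrixOf U)) = newtonPolygon (charSeries (b.matrixOf D)) := by
  subst hU
  have hd : ∀ k, ‖b.matrixOf D k k‖ ≤ 1 := fun k => by
    obtain ⟨c, hc⟩ := hDint k k
    rw [hc]
    exact c.norm_le_one
  have hI : IsCongruentToOne (b.matrixOf (ContinuousLinearMap.id ℚ_[2] M)) :=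
    b.matrixOf_id ▸ isCongruentToOne_one
  -- Writing `D = Id ∘ D ∘ Id` lets the same computation apply to `D` and to `U`.
  have hDI : ContinuousLinearMap.id ℚ_[2] M ∘L D ∘L ContinuousLinearMap.id ℚ_[2] M = D := by
    ext; rfl
  have hsumU := b.hasPrincipalMinorSums_comp_comp hA hB hd hDdiag hDcomp
  have hsumD := b.hasPrincipalMinorSums_comp_comp hI hI hd hDdiag hDcomp
  have hXU := b.hasSum_matrixOf_comp_comp A B hDdiag
  have hXD := b.hasSum_matrixOf_comp_comp (ContinuousLinearMap.id ℚ_[2] M)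
    (ContinuousLinearMap.id ℚ_[2] M) hDdiag
  rw [hDI] at hsumD hXD
  have hfin := fun m : ℕ =>
    finite_setOf_valuation_lt (b.tendsto_diag_of_isCompactOperator hDdiag hDcomp) m
  have hK : ∀ (m : ℕ) (i : ℕ), i ∈ (hfin m).toFinset ↔
      b.matrixOf D i i ≠ 0 ∧ (b.matrixOf D i i).valuation < m := fun m i => by simp
  refine ⟨(hDcomp.comp_clm B).clm_comp A, hsumU, hsumD, ?_⟩
  rw [newtonPolygon_charSeries_eq hK hd hA hB hXU hsumU,
    newtonPolygon_charSeries_eq hK hd hI hI hXD hsumD]
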